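/- Let $n\ge 0$ be an integer and let $b$ be an analytic $n\times n$ matrix-valued function on the unit disc $\mathbb D$ with $\|b(z)\|<1$ for all $z\in\mathbb D$ (operator norm). Let $\boldsymbol\mu$ be the Clark measure of $b$ for $\alpha=I_n$, that is, the finite non-negative $\mathbb C^{n\times n}$-valued Borel measure on the unit circle $\mathbb T$ with $$H(z):=(I_n+b(z))(I_n-b(z))^{-1}=i\operatorname{Im}H(0)+\int_{\mathbb T}\frac{\zeta+z}{\zeta-z}\,\boldsymbol\mu(d\zeta),\qquad z\in\mathbb D,$$ where $\operatorname{Im}A=(A-A^*)/(2i)$. Write $d\boldsymbol\mu=W\,d\mu$ with $\mu=\operatorname{tr}\boldsymbol\mu$ and $W$ a measurable function with positive semidefinite values. Let $L^2(\boldsymbol\mu)$ be the space of Borel functions $f:\mathbb T\to\mathbb C^n$ with $\|f\|^2=\int (W f,f)_{\mathbb C^n}\,d\mu<\infty$, where functions at distance $0$ are identified. Let $L^2_+(\boldsymbol\mu)$ be the closed linear span in $L^2(\boldsymbol\mu)$ of the functions $\xi\mapsto \mathbf x/(1-\overline w\xi)$, $w\in\mathbb D$, $\mathbf x\in\mathbb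 C^n$. Let $\mathscr H(b)$ be the de Branges--Rovnyak space, i.e. the reproducing kernel Hilbert space of $\mathbb C^n$-valued functions on $\mathbb D$ with kernel $$k^b_w(z)=k^b(z,w)=\frac{I_n-b(z)b(w)^*}{1-z\overline w},\qquad z,w\in\mathbb D.$$ For $f\in L^2(\boldsymbol\mu)$ put $$\Psi f(z)=(I_n-b(z))\int_{\mathbb T}\frac{1}{1-z\overline\xi}\,d\boldsymbol\mu(\xi)f(\xi),\qquad z\in\mathbb D.$$ Then $\Psi$, restricted to $L^2_+(\boldsymbol\mu)$, is a unitary operator from $L^2_+(\boldsymbol\mu)$ onto $\mathscr H(b)$. Moreover, for all $w\in\mathbb D$ and $\mathbf x\in\mathbb C^n$, it sends the function $\widetilde k_w\mathbf x$, where $$\widetilde k_w(\xi)=\frac{I_n-b(w)^*}{1-\overline w\xi},\qquad \xi\in\mathbb T,$$ to $k^b_w\mathbf x$. -/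

import Mathlib

open MeasureTheory Complex
open scoped ComplexConjugate UnitDisc

noncomputable section

instance Circle.instMeasurableSpaceBorel : MeasurableSpace Circle := borel Circle

instance Circle.instBorelSpaceBorel : BorelSpace Circle := ⟨rfl⟩

/-- `ℂⁿ` with its Euclidean norm. -/
abbrev CVec (n : ℕ) := EuclideanSpace ℂ (Fin n)

/-- Complex `n × n` matrices, identified with the operators on `ℂⁿ`, with the operator norm. -/
abbrev CMat (n : ℕ) := CVec n →L[ℂ] CVec n

namespace CMat

variable {n : ℕ}

/-- The `(i, j)` entry of a matrix. -/
def entry (A : CMat n) (i j : Fin n) : ℂ := A (EuclideanSpace.single j 1) i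

/-- The matrix unit whose `(i, j)` entry is `1`. -/
def unit (i j : Fin n) : CMat n :=
  (EuclideanSpace.proj j : CVec n →L[ℂ] ℂ).smulRight (EuclideanSpace.single i 1)

theorem eq_sum_entry (A : CMat n) : A = ∑ i, ∑ j, A.entry i j • unit i j := by
  have h : ∀ v : CVec n, v = ∑ j, v j • EuclideanSpace.single j (1 : ℂ) := by
    intro v; ext i; simp [Pi.single_apply]
  ext v i
  conv_lhs => rw [h v]
  simp [entry, unit, Pi.single_apply, mul_comm]

theorem norm_apply_sq_le {A : CMat n} (hA : A.IsPositive) (v : CVec n) :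
    ‖A v‖ ^ 2 ≤ ‖A‖ * (inner ℂ v (A v)).re := by
  obtain ⟨B, rfl⟩ := CStarAlgebra.nonneg_iff_eq_star_mul_self.1
    ((ContinuousLinearMap.nonneg_iff_isPositive A).2 hA)
  have h1 : (inner ℂ v ((star B * B) v)).re = ‖B v‖ ^ 2 := by
    have := inner_self_eq_norm_sq (𝕜 := ℂ) (B v)
    rw [← this]
    simp [ContinuousLinearMap.star_eq_adjoint, ContinuousLinearMap.adjoint_inner_right]
  rw [h1, CStarRing.norm_star_mul_self]
  have h2 : ‖(star B * B) v‖ ≤ ‖B‖ * ‖B v‖ := by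
    have := (star B).le_opNorm (B v)
    rwa [show ‖star B‖ = ‖B‖ from norm_star B] at this
  calc _ ≤ (‖B‖ * ‖B v‖) ^ 2 := by gcongr
    _ = _ := by ring

theorem norm_apply_le {A : CMat n} (hA : A.IsPositive) (v : CVec n) :
    ‖A v‖ ≤ ‖A‖ + (inner ℂ v (A v)).re := by
  have h := norm_apply_sq_le hA v
  have h0 : 0 ≤ (inner ℂ v (A v)).re := hA.re_inner_nonneg_right v
  have h1 := norm_nonneg A
  nlinarith [norm_nonneg (A v), sq_nonneg (‖A‖ - (inner ℂ v (A v)).re)]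

/-- The real part of the trace. -/
def reTrace (n : ℕ) : CMat n →+ ℝ where
  toFun A := ∑ k, (A.entry k k).re
  map_zero' := by simp [entry]
  map_add' A B := by simp [entry, Finset.sum_add_distrib]

theorem continuous_entry (i j : Fin n) : Continuous fun A : CMat n => A.entry i j := by
  unfold entry; fun_prop

theorem continuous_reTrace (n : ℕ) : Continuous (reTrace n) := by
  change Continuous fun A : CMat n => ∑ k, (A.entry k k).re
  have := fun k : Fin n => continuous_entry k k
  fun_prop

theorem reTrace_nonneg {A : CMat n} (hA : A.IsPositive) : 0 ≤ reTrace n A := by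
  change 0 ≤ ∑ k, (A.entry k k).re
  refine Finset.sum_nonneg fun k _ => ?_
  have := hA.re_inner_nonneg_right (EuclideanSpace.single k 1)
  simpa [EuclideanSpace.inner_single_left, entry] using this

theorem eq_zero_of_reTrace {A : CMat n} (hA : A.IsPositive) (h : reTrace n A = 0) : A = 0 := by
  have h0 : ∀ k, 0 ≤ (A.entry k k).re := fun k => by
    have := hA.re_inner_nonneg_right (EuclideanSpace.single k 1)
    simpa [EuclideanSpace.inner_single_left, entry] using this
  change ∑ k, (A.entry k k).re = 0 at h
  have h1 := (Finset.sum_eq_zero_iff_of_nonneg fun k _ => h0 k).1 h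
  have h2 : ∀ k, A (EuclideanSpace.single k 1) = 0 := fun k => by
    have := norm_apply_sq_le hA (EuclideanSpace.single k 1)
    have h3 := h1 k (Finset.mem_univ k)
    simp only [EuclideanSpace.inner_single_left, map_one, one_mul] at this
    rw [show (A (EuclideanSpace.single k 1)).ofLp k = A.entry k k from rfl, h3, mul_zero] at this
    exact norm_eq_zero.1 (pow_eq_zero_iff two_ne_zero |>.1 (le_antisymm this (sq_nonneg _)))
  ext v i
  rw [eq_sum_entry A]
  simp [entry, h2]

end CMat

/-- A finite non-negative `n × n` matrix-valued Borel measure on the unit circle. -/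
structure MatrixMeasure (n : ℕ) where
  toVectorMeasure : VectorMeasure Circle (CMat n)
  isPositive : ∀ E, MeasurableSet E → (toVectorMeasure E).IsPositive

namespace MatrixMeasure

variable {n : ℕ} (μ : MatrixMeasure n)

/-- The trace measure `tr μ`. -/
def trace : Measure Circle :=
  Measure.ofMeasurable (fun E _ => ENNReal.ofReal (CMat.reTrace n (μ.toVectorMeasure E)))
    (by simp)
    (by
      intro f hf hd
      have h1 := (μ.toVectorMeasure.mapRange _ (CMat.continuous_reTrace n)).m_iUnion hf hd
      have h2 : ∀ i, 0 ≤ CMat.reTrace n (μ.toVectorMeasure (f i)) :=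
        fun i => CMat.reTrace_nonneg (μ.isPositive _ (hf i))
      rw [← ENNReal.ofReal_tsum_of_nonneg h2 h1.summable]
      congr 1
      exact h1.tsum_eq.symm)

theorem trace_apply {E : Set Circle} (hE : MeasurableSet E) :
    μ.trace E = ENNReal.ofReal (CMat.reTrace n (μ.toVectorMeasure E)) :=
  Measure.ofMeasurable_apply E hE

instance : IsFiniteMeasure μ.trace :=
  ⟨by rw [μ.trace_apply MeasurableSet.univ]; exact ENNReal.ofReal_lt_top⟩

theorem eq_zero_of_trace {E : Set Circle} (hE : MeasurableSet E) (h : μ.trace E = 0) :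
    μ.toVectorMeasure E = 0 := by
  rw [μ.trace_apply hE, ENNReal.ofReal_eq_zero] at h
  exact CMat.eq_zero_of_reTrace (μ.isPositive E hE)
    (le_antisymm h (CMat.reTrace_nonneg (μ.isPositive E hE)))

theorem exists_real_density (τ : Measure Circle) [IsFiniteMeasure τ] (s : SignedMeasure Circle)
    (h : ∀ E, MeasurableSet E → τ E = 0 → s E = 0) :
    ∃ f : Circle → ℝ, Measurable f ∧ Integrable f τ ∧
      ∀ E, MeasurableSet E → s E = ∫ ξ in E, f ξ ∂τ := by
  refine ⟨s.rnDeriv τ, SignedMeasure.measurable_rnDeriv _ _, SignedMeasure.integrable_rnDeriv _ _,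
    fun E hE => ?_⟩
  have h1 := SignedMeasure.withDensityᵥ_rnDeriv_eq s τ
    (VectorMeasure.AbsolutelyContinuous.mk fun E hE h0 => h E hE (by
      rwa [Measure.toENNRealVectorMeasure_apply_measurable hE] at h0))
  conv_lhs => rw [← h1]
  exact withDensityᵥ_apply (SignedMeasure.integrable_rnDeriv _ _) hE

theorem exists_entry_density (i j : Fin n) :
    ∃ f : Circle → ℂ, Measurable f ∧ Integrable f μ.trace ∧
      ∀ E, MeasurableSet E → (μ.toVectorMeasure E).entry i j = ∫ ξ in E, f ξ ∂μ.trace := by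
  have h0 : ∀ E, MeasurableSet E → μ.trace E = 0 → (μ.toVectorMeasure E).entry i j = 0 :=
    fun E hE h => by rw [μ.eq_zero_of_trace hE h]; simp [CMat.entry]
  obtain ⟨f, hf, hfi, hfE⟩ := exists_real_density μ.trace
    (μ.toVectorMeasure.mapRange
      (⟨⟨fun A => (A.entry i j).re, by simp [CMat.entry]⟩, fun A B => by simp [CMat.entry]⟩ :
        CMat n →+ ℝ) (Complex.continuous_re.comp (CMat.continuous_entry i j)))
    (fun E hE h => congrArg Complex.re (h0 E hE h))
  obtain ⟨g, hg, hgi, hgE⟩ := exists_real_density μ.trace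
    (μ.toVectorMeasure.mapRange
      (⟨⟨fun A => (A.entry i j).im, by simp [CMat.entry]⟩, fun A B => by simp [CMat.entry]⟩ :
        CMat n →+ ℝ) (Complex.continuous_im.comp (CMat.continuous_entry i j)))
    (fun E hE h => congrArg Complex.im (h0 E hE h))
  refine ⟨fun ξ => f ξ + g ξ * I, by fun_prop, hfi.ofReal.add (hgi.ofReal.mul_const I),
    fun E hE => ?_⟩
  have e1 : Integrable (fun ξ => (f ξ : ℂ)) (μ.trace.restrict E) := hfi.ofReal.integrableOn
  have e2 : Integrable (fun ξ => (g ξ : ℂ) * I) (μ.trace.restrict E) :=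
    (hgi.ofReal.mul_const I).integrableOn
  rw [integral_add e1 e2, integral_mul_const, integral_complex_ofReal, integral_complex_ofReal,
    ← hfE E hE, ← hgE E hE]
  exact (Complex.re_add_im _).symm

theorem sum_smul_density {ι G : Type*} [Fintype ι] [NormedAddCommGroup G] [NormedSpace ℂ G]
    [MeasurableSpace G] [BorelSpace G] [SecondCountableTopology G] [CompleteSpace G]
    (τ : Measure Circle) (u : ι → G)
    (f : ι → Circle → ℂ) (hf : ∀ i, Measurable (f i)) (hfi : ∀ i, Integrable (f i) τ) :
    Measurable (fun ξ => ∑ i, f i ξ • u i) ∧ Integrable (fun ξ => ∑ i, f i ξ • u i) τ ∧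
      ∀ E : Set Circle, ∫ ξ in E, (∑ i, f i ξ • u i) ∂τ = ∑ i, (∫ ξ in E, f i ξ ∂τ) • u i := by
  have hi : ∀ i, Integrable (fun ξ => f i ξ • u i) τ := fun i => (hfi i).smul_const _
  refine ⟨Finset.measurable_fun_sum _ fun i _ => (hf i).smul_const _,
    integrable_finsetSum _ fun i _ => hi i, fun E => ?_⟩
  rw [integral_finsetSum _ fun i _ => (hi i).integrableOn]
  exact Finset.sum_congr rfl fun i _ => integral_smul_const _ _

theorem exists_density_aux : ∃ V : Circle → CMat n, Measurable V ∧ Integrable V μ.trace ∧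
    ∀ E, MeasurableSet E → μ.toVectorMeasure E = ∫ ξ in E, V ξ ∂μ.trace := by
  choose f hf hfi hfE using μ.exists_entry_density
  obtain ⟨h1, h2, h3⟩ := sum_smul_density (G := CMat n) (ι := Fin n × Fin n) μ.trace
    (fun p => CMat.unit p.1 p.2) (fun p => f p.1 p.2) (fun p => hf p.1 p.2)
    (fun p => hfi p.1 p.2)
  refine ⟨_, h1, h2, fun E hE => ?_⟩
  rw [h3 E, Fintype.sum_prod_type]
  refine (CMat.eq_sum_entry (μ.toVectorMeasure E)).trans ?_
  exact Finset.sum_congr rfl fun i _ => Finset.sum_congr rfl fun j _ => by rw [hfE i j E hE]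

theorem ae_isPositive {V : Circle → CMat n} (hVi : Integrable V μ.trace)
    (hVE : ∀ E, MeasurableSet E → μ.toVectorMeasure E = ∫ ξ in E, V ξ ∂μ.trace) :
    ∀ᵐ ξ ∂μ.trace, (V ξ).IsPositive := by
  have hq : ∀ x : CVec n, Integrable (fun ξ => inner ℂ x (V ξ x)) μ.trace := fun x =>
    (hVi.apply_continuousLinearMap x).const_inner x
  have hqE : ∀ (x : CVec n) (E), MeasurableSet E →
      ∫ ξ in E, inner ℂ x (V ξ x) ∂μ.trace = inner ℂ x (μ.toVectorMeasure E x) := by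
    intro x E hE
    rw [hVE E hE, ContinuousLinearMap.integral_apply hVi.integrableOn,
      integral_inner ((hVi.apply_continuousLinearMap x).integrableOn)]
  have hre : ∀ x : CVec n, ∀ᵐ ξ ∂μ.trace, 0 ≤ (inner ℂ x (V ξ x)).re := by
    intro x
    refine ae_nonneg_of_forall_setIntegral_nonneg (hq x).re fun E hE _ => ?_
    have := integral_re (hq x).integrableOn (μ := μ.trace.restrict E)
    rw [hqE x E hE] at this
    exact this.symm ▸ (μ.isPositive E hE).re_inner_nonneg_right x
  have him : ∀ x : CVec n, ∀ᵐ ξ ∂μ.trace, (inner ℂ x (V ξ x)).im = 0 := by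
    intro x
    refine (hq x).im.ae_eq_zero_of_forall_setIntegral_eq_zero fun E hE _ => ?_
    have := integral_im (hq x).integrableOn (μ := μ.trace.restrict E)
    rw [this, hqE x E hE]
    have h3 := (μ.isPositive E hE).inner_nonneg_right x
    exact (RCLike.nonneg_iff.1 h3).2
  have h1 := ae_all_iff.2 fun k : ℕ => hre (TopologicalSpace.denseSeq (CVec n) k)
  have h2 := ae_all_iff.2 fun k : ℕ => him (TopologicalSpace.denseSeq (CVec n) k)
  filter_upwards [h1, h2] with ξ h1 h2
  rw [ContinuousLinearMap.isPositive_iff_complex]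
  have hd := TopologicalSpace.denseRange_denseSeq (CVec n)
  have c : Continuous fun x : CVec n => inner ℂ x (V ξ x) := by fun_prop
  have e1 : ∀ x : CVec n, 0 ≤ (inner ℂ x (V ξ x)).re := fun x =>
    hd.induction_on (p := fun x => 0 ≤ (inner ℂ x (V ξ x)).re) x
      (isClosed_le continuous_const (Complex.continuous_re.comp c)) h1
  have e2 : ∀ x : CVec n, (inner ℂ x (V ξ x)).im = 0 := fun x =>
    hd.induction_on (p := fun x => (inner ℂ x (V ξ x)).im = 0) x
      (isClosed_eq (Complex.continuous_im.comp c) continuous_const) h2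
  intro x
  have e3 : inner ℂ (V ξ x) x = inner ℂ x (V ξ x) := by
    rw [← inner_conj_symm, Complex.conj_eq_iff_im.2 (e2 x)]
  rw [e3]
  refine ⟨?_, e1 x⟩
  apply Complex.ext
  · simp
  · simp [e2 x]

theorem measurableSet_isPositive : MeasurableSet {A : CMat n | A.IsPositive} := by
  have : {A : CMat n | A.IsPositive} = {A : CMat n | 0 ≤ A} := by
    ext A; exact (ContinuousLinearMap.nonneg_iff_isPositive A).symm
  rw [this]
  exact (CStarAlgebra.isClosed_nonneg (A := CMat n)).measurableSet

/-- The Radon-Nikodym theorem for a non-negative matrix-valued measure and its trace. -/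
theorem exists_density : ∃ W : Circle → CMat n, Measurable W ∧ Integrable W μ.trace ∧
    (∀ ξ, (W ξ).IsPositive) ∧
    ∀ E, MeasurableSet E → μ.toVectorMeasure E = ∫ ξ in E, W ξ ∂μ.trace := by
  obtain ⟨V, hV, hVi, hVE⟩ := μ.exists_density_aux
  have hpos := μ.ae_isPositive hVi hVE
  have hVW : V =ᵐ[μ.trace] (V ⁻¹' {A | A.IsPositive}).indicator V := by
    filter_upwards [hpos] with ξ h
    exact (Set.indicator_of_mem (s := V ⁻¹' {A | A.IsPositive}) h V).symm
  refine ⟨_, hV.indicator (hV measurableSet_isPositive), hVi.congr hVW, fun ξ => ?_,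
    fun E hE => ?_⟩
  · by_cases h : (V ξ).IsPositive
    · rwa [Set.indicator_of_mem (s := V ⁻¹' {A | A.IsPositive}) h V]
    · rw [Set.indicator_of_notMem (s := V ⁻¹' {A | A.IsPositive}) h V]
      exact ContinuousLinearMap.isPositive_zero
  · rw [hVE E hE]
    exact integral_congr_ae (ae_restrict_of_ae hVW)

end MatrixMeasure

namespace CMat

variable {n : ℕ}

theorem norm_inner_le {A : CMat n} (hA : A.IsPositive) (u v : CVec n) :
    ‖inner ℂ u (A v)‖ ≤ (inner ℂ u (A u)).re + (inner ℂ v (A v)).re := by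
  obtain ⟨B, rfl⟩ := CStarAlgebra.nonneg_iff_eq_star_mul_self.1
    ((ContinuousLinearMap.nonneg_iff_isPositive A).2 hA)
  have h0 : ∀ x y : CVec n, inner ℂ x ((star B * B) y) = inner ℂ (B x) (B y) := fun x y => by
    simp [ContinuousLinearMap.star_eq_adjoint, ContinuousLinearMap.adjoint_inner_right]
  have h1 : ∀ x : CVec n, (inner ℂ (B x) (B x)).re = ‖B x‖ ^ 2 := fun x =>
    inner_self_eq_norm_sq (𝕜 := ℂ) (B x)
  rw [h0, h0, h0, h1, h1]
  have := norm_inner_le_norm (𝕜 := ℂ) (B u) (B v)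
  nlinarith [sq_nonneg (‖B u‖ - ‖B v‖), sq_nonneg (‖B u‖), sq_nonneg ‖B v‖]

end CMat

namespace MatrixMeasure

variable {n : ℕ} (μ : MatrixMeasure n)

/-- The density `W` of `μ` with respect to its trace: `dμ = W d(tr μ)`. -/
def density : Circle → CMat n := Classical.choose μ.exists_density

theorem measurable_density : Measurable μ.density := (Classical.choose_spec μ.exists_density).1

theorem integrable_density : Integrable μ.density μ.trace :=
  (Classical.choose_spec μ.exists_density).2.1

theorem isPositive_density (ξ : Circle) : (μ.density ξ).IsPositive :=
  (Classical.choose_spec μ.exists_density).2.2.1 ξ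

theorem apply_eq_integral_density {E : Set Circle} (hE : MeasurableSet E) :
    μ.toVectorMeasure E = ∫ ξ in E, μ.density ξ ∂μ.trace :=
  (Classical.choose_spec μ.exists_density).2.2.2 E hE

theorem measurable_density_apply {f : Circle → CVec n} (hf : Measurable f) :
    Measurable fun ξ => μ.density ξ (f ξ) := by
  have h : Continuous fun p : CMat n × CVec n => p.1 p.2 := by fun_prop
  exact h.measurable.comp (μ.measurable_density.prodMk hf)

/-- `f` is a Borel function with `∫ (W f, f) d(tr μ) < ∞`. -/
def MemL2 (f : Circle → CVec n) : Prop :=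
  Measurable f ∧ Integrable (fun ξ => (inner ℂ (f ξ) (μ.density ξ (f ξ))).re) μ.trace

variable {μ}

theorem MemL2.integrable_inner {f g : Circle → CVec n} (hf : μ.MemL2 f) (hg : μ.MemL2 g) :
    Integrable (fun ξ => inner ℂ (f ξ) (μ.density ξ (g ξ))) μ.trace :=
  (hf.2.add hg.2).mono'
    ((hf.1.inner (μ.measurable_density_apply hg.1)).aestronglyMeasurable)
    (Filter.Eventually.of_forall fun ξ => CMat.norm_inner_le (μ.isPositive_density ξ) _ _)

theorem MemL2.integrable_density_apply {f : Circle → CVec n} (hf : μ.MemL2 f) :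
    Integrable (fun ξ => μ.density ξ (f ξ)) μ.trace :=
  (μ.integrable_density.norm.add hf.2).mono'
    (μ.measurable_density_apply hf.1).aestronglyMeasurable
    (Filter.Eventually.of_forall fun ξ => CMat.norm_apply_le (μ.isPositive_density ξ) _)

variable (μ)

/-- The Borel functions `f : 𝕋 → ℂⁿ` with `∫ (W f, f) d(tr μ) < ∞`, as a vector space. -/
def l2Submodule : Submodule ℂ (Circle → CVec n) where
  carrier := {f | μ.MemL2 f}
  zero_mem' := ⟨measurable_const, by simp⟩
  add_mem' {f g} hf hg := by
    refine ⟨hf.1.add hg.1, ?_⟩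
    have := ((hf.integrable_inner hf).add (hf.integrable_inner hg)).add
      ((hg.integrable_inner hf).add (hg.integrable_inner hg))
    refine this.re.congr (Filter.Eventually.of_forall fun ξ => ?_)
    simp
    ring
  smul_mem' c f hf := by
    refine ⟨hf.1.const_smul c, ?_⟩
    refine (((hf.integrable_inner hf).const_mul (c * conj c)).re).congr
      (Filter.Eventually.of_forall fun ξ => ?_)
    simp only [Pi.smul_apply, map_smul, inner_smul_left, inner_smul_right, ← mul_assoc]
    rfl

/-- The semi-inner product space of Borel functions `f : 𝕋 → ℂⁿ` with
`∫ (W f, f) d(tr μ) < ∞`, before functions at distance zero are identified. -/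
def L2Fun : Type := μ.l2Submodule

instance : AddCommGroup μ.L2Fun := inferInstanceAs (AddCommGroup μ.l2Submodule)

instance : Module ℂ μ.L2Fun := inferInstanceAs (Module ℂ μ.l2Submodule)

/-- The underlying function of an element of `L2Fun`. -/
def coeFn : μ.L2Fun →ₗ[ℂ] (Circle → CVec n) := μ.l2Submodule.subtype

instance : CoeFun μ.L2Fun fun _ => Circle → CVec n := ⟨fun f => μ.coeFn f⟩

theorem memL2 (f : μ.L2Fun) : μ.MemL2 f := f.2

/-- The semi-inner product; Mathlib's inner products are linear in the second variable, so
this is `∫ (W g, f) d(tr μ)` with the inner product of `ℂⁿ` linear in the first variable. -/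
instance : PreInnerProductSpace.Core ℂ μ.L2Fun where
  inner f g := ∫ ξ, inner ℂ (f ξ) (μ.density ξ (g ξ)) ∂μ.trace
  conj_inner_symm f g := by
    rw [← integral_conj]
    refine integral_congr_ae (Filter.Eventually.of_forall fun ξ => ?_)
    simp only [inner_conj_symm]
    exact (μ.isPositive_density ξ).inner_left_eq_inner_right _ _
  re_inner_nonneg f := by
    rw [← integral_re ((μ.memL2 f).integrable_inner (μ.memL2 f))]
    exact integral_nonneg fun ξ => (μ.isPositive_density ξ).re_inner_nonneg_right _
  add_left f g h := by
    rw [← integral_add ((μ.memL2 f).integrable_inner (μ.memL2 h))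
      ((μ.memL2 g).integrable_inner (μ.memL2 h))]
    simp
  smul_left f g c := by
    rw [← integral_const_mul]
    simp [mul_comm]

instance : SeminormedAddCommGroup μ.L2Fun :=
  InnerProductSpace.Core.toSeminormedAddCommGroup (𝕜 := ℂ)

instance : InnerProductSpace ℂ μ.L2Fun := InnerProductSpace.ofCore _

theorem inner_def (f g : μ.L2Fun) :
    inner ℂ f g = ∫ ξ, inner ℂ (f ξ) (μ.density ξ (g ξ)) ∂μ.trace := rfl

/-- The weighted space `L²(μ)`. -/
abbrev L2 : Type := SeparationQuotient μ.L2Fun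

/-- The class in `L²(μ)` of a Borel function with `∫ (W f, f) d(tr μ) < ∞`. -/
def toL2 : μ.L2Fun →ₗ[ℂ] μ.L2 := (SeparationQuotient.mkCLM ℂ μ.L2Fun).toLinearMap

theorem one_sub_ne_zero (w : 𝔻) (ξ : Circle) : 1 - conj (w : ℂ) * (ξ : ℂ) ≠ 0 := by
  intro h
  have h1 : ‖conj (w : ℂ) * (ξ : ℂ)‖ = 1 := by rw [← sub_eq_zero.1 h]; simp
  rw [norm_mul, Circle.norm_coe, mul_one, RCLike.norm_conj] at h1
  exact absurd h1 w.norm_ne_one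

theorem memL2_fraction (w : 𝔻) (x : CVec n) :
    μ.MemL2 fun ξ => (1 / (1 - conj (w : ℂ) * (ξ : ℂ))) • x := by
  have hc : Continuous fun ξ : Circle => (1 / (1 - conj (w : ℂ) * (ξ : ℂ))) := by
    refine Continuous.div continuous_const (by fun_prop) (one_sub_ne_zero w)
  have hm : Measurable fun ξ : Circle => (1 / (1 - conj (w : ℂ) * (ξ : ℂ))) • x :=
    (hc.smul continuous_const).measurable
  refine ⟨hm, ?_⟩
  obtain ⟨C, hC⟩ := (isCompact_univ (X := Circle)).exists_bound_of_continuousOn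
    (hc.smul (continuous_const (y := x))).continuousOn
  refine (μ.integrable_density.norm.mul_const (C ^ 2)).mono'
    (Complex.measurable_re.comp (hm.inner (μ.measurable_density_apply hm))).aestronglyMeasurable
    (Filter.Eventually.of_forall fun ξ => ?_)
  have h1 : ‖(1 / (1 - conj (w : ℂ) * (ξ : ℂ))) • x‖ ≤ C := hC ξ (Set.mem_univ _)
  set v := (1 / (1 - conj (w : ℂ) * (ξ : ℂ))) • x
  calc ‖(inner ℂ v (μ.density ξ v)).re‖ ≤ ‖inner ℂ v (μ.density ξ v)‖ := Complex.abs_re_le_norm _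
    _ ≤ ‖v‖ * ‖μ.density ξ v‖ := norm_inner_le_norm _ _
    _ ≤ ‖v‖ * (‖μ.density ξ‖ * ‖v‖) := by gcongr; exact (μ.density ξ).le_opNorm v
    _ = ‖μ.density ξ‖ * ‖v‖ ^ 2 := by ring
    _ ≤ _ := by gcongr

/-- The vector rational fraction `r_{w,x}(ξ) = x / (1 - w̄ ξ)`. -/
def fraction (w : 𝔻) (x : CVec n) : μ.L2Fun :=
  ⟨fun ξ => (1 / (1 - conj (w : ℂ) * (ξ : ℂ))) • x, μ.memL2_fraction w x⟩

/-- `L²₊(μ)`: the closed linear span in `L²(μ)` of the fractions `r_{w,x}`. -/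
def L2plus : Submodule ℂ μ.L2 :=
  (Submodule.span ℂ {f | ∃ (w : 𝔻) (x : CVec n), f = μ.toL2 (μ.fraction w x)}).topologicalClosure

theorem fraction_mem_L2plus (w : 𝔻) (x : CVec n) : μ.toL2 (μ.fraction w x) ∈ μ.L2plus :=
  subset_closure (Submodule.subset_span ⟨w, x, rfl⟩)

theorem integrable_continuous_smul {G : Type*} [NormedAddCommGroup G] [NormedSpace ℂ G]
    {τ : Measure Circle} {c : Circle → ℂ} (hc : Continuous c) {g : Circle → G}
    (hg : Integrable g τ) : Integrable (fun ξ => c ξ • g ξ) τ := by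
  obtain ⟨C, hC⟩ := (isCompact_univ (X := Circle)).exists_bound_of_continuousOn hc.continuousOn
  exact hg.bdd_smul C hc.aestronglyMeasurable
    (Filter.Eventually.of_forall fun ξ => hC ξ (Set.mem_univ _))

/-- The Cauchy transform `C[μ f](z) = ∫ (1 - z ξ̄)⁻¹ dμ(ξ) f(ξ)`. -/
def cauchyTransform (f : Circle → CVec n) (z : 𝔻) : CVec n :=
  ∫ ξ : Circle, (1 / (1 - (z : ℂ) * conj (ξ : ℂ))) • μ.density ξ (f ξ) ∂μ.trace

theorem integrable_cauchyTransform (f : μ.L2Fun) (z : 𝔻) :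
    Integrable (fun ξ : Circle => (1 / (1 - (z : ℂ) * conj (ξ : ℂ))) • μ.density ξ (f ξ))
      μ.trace := by
  have hc : Continuous fun ξ : Circle => 1 / (1 - (z : ℂ) * conj (ξ : ℂ)) := by
    refine Continuous.div continuous_const (by fun_prop) fun ξ h => ?_
    apply one_sub_ne_zero z ξ
    have := congrArg conj h
    simpa using this
  exact integrable_continuous_smul hc (μ.memL2 f).integrable_density_apply

theorem cauchyTransform_add (f g : μ.L2Fun) (z : 𝔻) :
    μ.cauchyTransform (μ.coeFn (f + g)) z = μ.cauchyTransform f z + μ.cauchyTransform g z := by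
  unfold cauchyTransform
  rw [← integral_add (μ.integrable_cauchyTransform f z) (μ.integrable_cauchyTransform g z)]
  simp

theorem cauchyTransform_smul (c : ℂ) (f : μ.L2Fun) (z : 𝔻) :
    μ.cauchyTransform (μ.coeFn (c • f)) z = c • μ.cauchyTransform f z := by
  unfold cauchyTransform
  rw [← integral_smul]
  simp only [map_smul, Pi.smul_apply, smul_comm c]

theorem ae_density_apply_eq_zero (f : μ.L2Fun) (hf : ‖f‖ = 0) :
    ∀ᵐ ξ ∂μ.trace, μ.density ξ (f ξ) = 0 := by
  have h1 : RCLike.re (inner ℂ f f) = 0 := by rw [inner_self_eq_norm_sq, hf]; simp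
  rw [inner_def, ← integral_re ((μ.memL2 f).integrable_inner (μ.memL2 f))] at h1
  have h2 := (integral_eq_zero_iff_of_nonneg (fun ξ =>
    (μ.isPositive_density ξ).re_inner_nonneg_right _)
    ((μ.memL2 f).integrable_inner (μ.memL2 f)).re).1 h1
  filter_upwards [h2] with ξ h
  have h3 := CMat.norm_apply_sq_le (μ.isPositive_density ξ) (f ξ)
  have h4 : (inner ℂ (f ξ) (μ.density ξ (f ξ))).re = 0 := h
  rw [h4, mul_zero] at h3
  exact norm_eq_zero.1 (pow_eq_zero_iff two_ne_zero |>.1 (le_antisymm h3 (sq_nonneg _)))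

theorem cauchyTransform_congr {f g : μ.L2Fun} (h : Inseparable f g) (z : 𝔻) :
    μ.cauchyTransform f z = μ.cauchyTransform g z := by
  have h1 := μ.ae_density_apply_eq_zero (f - g) (by
    rw [← dist_eq_norm]; exact Metric.inseparable_iff.1 h)
  refine integral_congr_ae ?_
  filter_upwards [h1] with ξ h
  rw [map_sub, Pi.sub_apply, map_sub, sub_eq_zero] at h
  rw [h]

end MatrixMeasure

/-- The matrix-valued Schur class: purely contractive analytic matrix functions on the disc.
Values of `toFun` outside the open unit disc are irrelevant. -/
structure SchurClass (n : ℕ) where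
  toFun : ℂ → CMat n
  differentiableOn : DifferentiableOn ℂ toFun (Metric.ball 0 1)
  norm_lt_one : ∀ z ∈ Metric.ball (0 : ℂ) 1, ‖toFun z‖ < 1

namespace SchurClass

variable {n : ℕ}

instance : CoeFun (SchurClass n) fun _ => ℂ → CMat n := ⟨SchurClass.toFun⟩

/-- The kernel `k^b(z, w) = (I - b(z) b(w)^*) / (1 - z w̄)`. -/
def kernel (b : SchurClass n) : Matrix 𝔻 𝔻 (CMat n) :=
  Matrix.of fun z w => (1 / (1 - (z : ℂ) * conj (w : ℂ))) • (1 - b z * star (b w))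

theorem one_sub_conj_mul_ne_zero (w : 𝔻) {ζ : ℂ} (hζ : ‖ζ‖ ≤ 1) : 1 - conj (w : ℂ) * ζ ≠ 0 := by
  intro h
  have h1 : ‖conj (w : ℂ) * ζ‖ = 1 := by rw [← sub_eq_zero.1 h]; simp
  rw [norm_mul, RCLike.norm_conj] at h1
  have := w.norm_lt_one
  nlinarith [norm_nonneg ζ, norm_nonneg (w : ℂ)]

theorem circleAverage_inner_fraction {F : ℂ → CVec n}
    (hF : ∀ ζ ∈ Metric.closedBall (0 : ℂ) 1, DifferentiableAt ℂ F ζ) (w : 𝔻) (y : CVec n) :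
    Real.circleAverage (fun ζ => inner ℂ ((1 - conj (w : ℂ) * ζ)⁻¹ • y) (F ζ)) 0 1 =
      inner ℂ y (F w) := by
  have hG : DiffContOnCl ℂ (fun ζ => inner ℂ y (F ζ)) (Metric.ball 0 |1|) := by
    refine DifferentiableOn.diffContOnCl fun ζ hζ => ?_
    rw [abs_one, closure_ball _ one_ne_zero] at hζ
    exact ((innerSL ℂ y).differentiableAt.comp ζ (hF ζ hζ)).differentiableWithinAt
  have h := hG.circleAverage_smul_div (w := (w : ℂ)) (by simp [w.norm_lt_one])
  rw [← h]
  refine Real.circleAverage_congr_sphere fun ζ hζ => ?_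
  have h1 : ‖ζ‖ = 1 := by simpa using hζ
  have h2 : ζ * conj ζ = 1 := by rw [Complex.mul_conj, Complex.normSq_eq_norm_sq, h1]; simp
  have h3 : ζ ≠ 0 := fun h => by simp [h] at h1
  have h4 : conj (1 - conj (w : ℂ) * ζ) ≠ 0 := by
    rw [Ne, map_eq_zero]; exact one_sub_conj_mul_ne_zero w h1.le
  have h5 : ζ - w ≠ 0 := fun h => by
    have : ζ = w := sub_eq_zero.1 h
    exact w.norm_ne_one (this ▸ h1)
  simp only [inner_smul_left, smul_eq_mul, sub_zero]
  congr 1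
  simp only [map_inv₀, map_sub, map_one, map_mul, Complex.conj_conj] at h4 ⊢
  field_simp
  linear_combination (w : ℂ) * h2

theorem circleAverage_inner_sum {F : ℂ → CVec n}
    (hF : ∀ ζ ∈ Metric.closedBall (0 : ℂ) 1, DifferentiableAt ℂ F ζ) (S : Finset 𝔻)
    (y : 𝔻 → CVec n) :
    Real.circleAverage (fun ζ => inner ℂ (∑ j ∈ S, (1 - conj (j : ℂ) * ζ)⁻¹ • y j) (F ζ)) 0 1 =
      ∑ j ∈ S, inner ℂ (y j) (F j) := by
  simp only [sum_inner]
  rw [Real.circleAverage_fun_sum]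
  · exact Finset.sum_congr rfl fun j _ => circleAverage_inner_fraction hF j (y j)
  · intro j _
    refine ContinuousOn.circleIntegrable' fun ζ hζ => ?_
    have h1 : ‖ζ‖ = 1 := by simpa using hζ
    refine (ContinuousAt.inner ?_ (hF ζ (by simp [h1])).continuousAt).continuousWithinAt
    exact ((by fun_prop : ContinuousAt (fun ζ : ℂ => 1 - conj (j : ℂ) * ζ) ζ).inv₀
      (one_sub_conj_mul_ne_zero j h1.le)).smul continuousAt_const

theorem differentiableAt_sum (S : Finset 𝔻) (y : 𝔻 → CVec n) :
    ∀ ζ ∈ Metric.closedBall (0 : ℂ) 1,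
      DifferentiableAt ℂ (fun ζ => ∑ j ∈ S, (1 - conj (j : ℂ) * ζ)⁻¹ • y j) ζ := by
  intro ζ hζ
  refine DifferentiableAt.fun_sum fun j _ => ?_
  exact ((by fun_prop : DifferentiableAt ℂ (fun ζ : ℂ => 1 - conj (j : ℂ) * ζ) ζ).inv
      (one_sub_conj_mul_ne_zero j (by simpa using hζ))).smul_const _

theorem sum_inner_le (c : ℂ → CMat n)
    (hc : ∀ ζ ∈ Metric.closedBall (0 : ℂ) 1, DifferentiableAt ℂ c ζ)
    (hc1 : ∀ ζ ∈ Metric.closedBall (0 : ℂ) 1, ‖c ζ‖ ≤ 1) (S : Finset 𝔻) (v : 𝔻 → CVec n) :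
    (∑ j ∈ S, inner ℂ (v j)
      (c j (∑ k ∈ S, (1 - conj (k : ℂ) * (j : ℂ))⁻¹ • star (c k) (v k)))).re ≤
    (∑ j ∈ S, inner ℂ (v j) (∑ k ∈ S, (1 - conj (k : ℂ) * (j : ℂ))⁻¹ • v k)).re := by
  set h : ℂ → CVec n := fun ζ => ∑ k ∈ S, (1 - conj (k : ℂ) * ζ)⁻¹ • star (c k) (v k) with hh
  set g : ℂ → CVec n := fun ζ => ∑ k ∈ S, (1 - conj (k : ℂ) * ζ)⁻¹ • v k with hg
  have dh := differentiableAt_sum S fun k => star (c k) (v k)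
  have dg := differentiableAt_sum S v
  have dch : ∀ ζ ∈ Metric.closedBall (0 : ℂ) 1, DifferentiableAt ℂ (fun ζ => c ζ (h ζ)) ζ :=
    fun ζ hζ => (hc ζ hζ).clm_apply (dh ζ hζ)
  have e1 := circleAverage_inner_sum dh S fun k => star (c k) (v k)
  have e2 := circleAverage_inner_sum dch S v
  have e3 := circleAverage_inner_sum dg S v
  have e4 : ∑ j ∈ S, inner ℂ (star (c j) (v j)) (h j) = ∑ j ∈ S, inner ℂ (v j) (c j (h j)) := by
    simp [ContinuousLinearMap.star_eq_adjoint, ContinuousLinearMap.adjoint_inner_left]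
  have ci : ∀ {p q : ℂ → CVec n}, (∀ ζ ∈ Metric.closedBall (0 : ℂ) 1, DifferentiableAt ℂ p ζ) →
      (∀ ζ ∈ Metric.closedBall (0 : ℂ) 1, DifferentiableAt ℂ q ζ) →
      CircleIntegrable (fun ζ => inner ℂ (p ζ) (q ζ)) 0 1 := fun hp hq => by
    refine ContinuousOn.circleIntegrable' fun ζ hζ => ?_
    have hζ' : ζ ∈ Metric.closedBall (0 : ℂ) 1 := by
      rw [abs_one] at hζ; exact Metric.sphere_subset_closedBall hζ
    exact ((hp ζ hζ').continuousAt.inner (hq ζ hζ').continuousAt).continuousWithinAt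
  have re_avg : ∀ {f : ℂ → ℂ}, CircleIntegrable f 0 1 →
      Real.circleAverage (fun ζ => (f ζ).re) 0 1 = (Real.circleAverage f 0 1).re := fun hf =>
    (Complex.reCLM.circleAverage_comp_comm hf)
  have re_int : ∀ {f : ℂ → ℂ}, CircleIntegrable f 0 1 →
      CircleIntegrable (fun ζ => (f ζ).re) 0 1 := fun hf => by
    exact ⟨hf.1.re, hf.2.re⟩
  have key : Real.circleAverage (fun ζ => (inner ℂ (g ζ) (c ζ (h ζ))).re) 0 1 ≤
      Real.circleAverage (fun ζ => (2⁻¹ : ℝ) • ((inner ℂ (g ζ) (g ζ)).re +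
        (inner ℂ (h ζ) (h ζ)).re)) 0 1 := by
    refine Real.circleAverage_mono (re_int (ci dg dch))
      (((re_int (ci dg dg)).add (re_int (ci dh dh))).const_smul) fun ζ hζ => ?_
    have hζ' : ζ ∈ Metric.closedBall (0 : ℂ) 1 := by
      rw [abs_one] at hζ; exact Metric.sphere_subset_closedBall hζ
    have i1 : (inner ℂ (g ζ) (g ζ)).re = ‖g ζ‖ ^ 2 := inner_self_eq_norm_sq (𝕜 := ℂ) _
    have i2 : (inner ℂ (h ζ) (h ζ)).re = ‖h ζ‖ ^ 2 := inner_self_eq_norm_sq (𝕜 := ℂ) _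
    have i3 : (inner ℂ (g ζ) (c ζ (h ζ))).re ≤ ‖g ζ‖ * ‖c ζ (h ζ)‖ := re_inner_le_norm (𝕜 := ℂ) _ _
    have i4 : ‖c ζ (h ζ)‖ ≤ ‖h ζ‖ := by
      have := (c ζ).le_opNorm (h ζ)
      have := hc1 ζ hζ'
      nlinarith [norm_nonneg (h ζ)]
    simp only [smul_eq_mul]
    rw [i1, i2]
    nlinarith [norm_nonneg (g ζ), norm_nonneg (h ζ), sq_nonneg (‖g ζ‖ - ‖h ζ‖)]
  rw [Real.circleAverage_fun_smul, Real.circleAverage_fun_add (re_int (ci dg dg))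
    (re_int (ci dh dh)), re_avg (ci dg dch), re_avg (ci dg dg), re_avg (ci dh dh), e1, e2, e3,
    e4, smul_eq_mul] at key
  linarith

theorem tendsto_clm_apply {l : Filter ℝ} {A : ℝ → CMat n} {A₀ : CMat n} {u : ℝ → CVec n}
    {u₀ : CVec n} (hA : Filter.Tendsto A l (nhds A₀)) (hu : Filter.Tendsto u l (nhds u₀)) :
    Filter.Tendsto (fun r => A r (u r)) l (nhds (A₀ u₀)) :=
  ((by fun_prop : Continuous fun p : CMat n × CVec n => p.1 p.2).tendsto (A₀, u₀)).comp
    (hA.prodMk_nhds hu)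

theorem sum_inner_le_of_schur (b : SchurClass n) (S : Finset 𝔻) (v : 𝔻 → CVec n) :
    (∑ j ∈ S, inner ℂ (v j)
      (b j (∑ k ∈ S, (1 - conj (k : ℂ) * (j : ℂ))⁻¹ • star (b k) (v k)))).re ≤
    (∑ j ∈ S, inner ℂ (v j) (∑ k ∈ S, (1 - conj (k : ℂ) * (j : ℂ))⁻¹ • v k)).re := by
  have hb : ∀ k : 𝔻, Filter.Tendsto (fun r : ℝ => b ((r : ℂ) * k)) (nhdsWithin 1 (Set.Iio 1))
      (nhds (b k)) := fun k => by
    have h1 : ContinuousAt b.toFun k := (b.differentiableOn.differentiableAt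
      (Metric.isOpen_ball.mem_nhds (by simp [k.norm_lt_one]))).continuousAt
    have h2 : Filter.Tendsto (fun r : ℝ => (r : ℂ) * k) (nhdsWithin 1 (Set.Iio 1)) (nhds k) := by
      have : Continuous fun r : ℝ => (r : ℂ) * (k : ℂ) := by fun_prop
      have := this.tendsto 1
      simp only [Complex.ofReal_one, one_mul] at this
      exact this.mono_left nhdsWithin_le_nhds
    exact h1.tendsto.comp h2
  have hT : Filter.Tendsto (fun r : ℝ => (∑ j ∈ S, inner ℂ (v j) (b ((r : ℂ) * j)
      (∑ k ∈ S, (1 - conj (k : ℂ) * (j : ℂ))⁻¹ • star (b ((r : ℂ) * k)) (v k)))).re)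
      (nhdsWithin 1 (Set.Iio 1)) (nhds (∑ j ∈ S, inner ℂ (v j) (b j
      (∑ k ∈ S, (1 - conj (k : ℂ) * (j : ℂ))⁻¹ • star (b k) (v k)))).re) := by
    refine (Complex.continuous_re.tendsto _).comp (tendsto_finsetSum _ fun j _ => ?_)
    refine tendsto_const_nhds.inner (tendsto_clm_apply (hb j) (tendsto_finsetSum _ fun k _ => ?_))
    exact (tendsto_clm_apply (((ContinuousLinearMap.adjoint (𝕜 := ℂ) (E := CVec n) (F := CVec n)).continuous.tendsto _).comp (hb k))
      tendsto_const_nhds).const_smul _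
  refine le_of_tendsto hT ?_
  filter_upwards [self_mem_nhdsWithin,
    mem_nhdsWithin_of_mem_nhds (lt_mem_nhds (zero_lt_one' ℝ))] with r hr1 hr0
  have hr : ∀ ζ ∈ Metric.closedBall (0 : ℂ) 1, (r : ℂ) * ζ ∈ Metric.ball (0 : ℂ) 1 := fun ζ hζ => by
    have h1 : ‖ζ‖ ≤ 1 := by simpa using hζ
    have h2 : r < 1 := hr1
    simp only [Metric.mem_ball, dist_zero_right, norm_mul, Complex.norm_real, Real.norm_eq_abs,
      abs_of_pos hr0]
    nlinarith [norm_nonneg ζ]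
  refine sum_inner_le (fun ζ => b ((r : ℂ) * ζ)) (fun ζ hζ => ?_)
    (fun ζ hζ => (b.norm_lt_one _ (hr ζ hζ)).le) S v
  exact (b.differentiableOn.differentiableAt (Metric.isOpen_ball.mem_nhds (hr ζ hζ))).comp ζ
    (by fun_prop)

theorem star_one_sub_mul {R : Type*} [Ring R] [StarRing R] (p q : R) :
    star (1 - p * star q) = 1 - q * star p := by simp

theorem isHermitian_kernel (b : SchurClass n) : b.kernel.IsHermitian := by
  refine Matrix.IsHermitian.ext fun z w => ?_
  simp only [kernel, Matrix.of_apply, star_smul]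
  rw [star_one_sub_mul]
  congr 1
  simp [mul_comm]

theorem posSemidef_kernel (b : SchurClass n) : b.kernel.PosSemidef := by
  have t := (RKHS.posSemidef_tfae (K := b.kernel)).out 0 2
  refine t.2 ⟨b.isHermitian_kernel, fun vv => ?_⟩
  have h := b.sum_inner_le_of_schur vv.support vv
  rw [← sub_nonneg, ← Complex.sub_re, ← Finset.sum_sub_distrib] at h
  have e : ∀ j k : 𝔻, conj (inner ℂ (b.kernel j k (vv k)) (vv j)) =
      inner ℂ (vv j) ((1 - conj (k : ℂ) * (j : ℂ))⁻¹ • vv k) -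
      inner ℂ (vv j) (b j ((1 - conj (k : ℂ) * (j : ℂ))⁻¹ • star (b k) (vv k))) := fun j k => by
    rw [inner_conj_symm, ← inner_sub_right, map_smul, ← smul_sub]
    simp [kernel, mul_comm]
  have e2 : ∑ j ∈ vv.support, (inner ℂ (vv j)
        (∑ k ∈ vv.support, (1 - conj (k : ℂ) * (j : ℂ))⁻¹ • vv k) -
      inner ℂ (vv j) (b j (∑ k ∈ vv.support, (1 - conj (k : ℂ) * (j : ℂ))⁻¹ •
        star (b k) (vv k)))) =
      conj (∑ k ∈ vv.support, ∑ j ∈ vv.support, inner ℂ (b.kernel j k (vv k)) (vv j)) := by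
    rw [Finset.sum_comm]
    simp only [map_sum, inner_sum, e, Finset.sum_sub_distrib]
  rw [e2, Complex.conj_re] at h
  exact h

instance (b : SchurClass n) : Fact b.kernel.PosSemidef := ⟨b.posSemidef_kernel⟩

/-- The de Branges–Rovnyak space `H(b)`: the reproducing kernel Hilbert space of functions
`𝔻 → ℂⁿ` with kernel `k^b`. -/
abbrev deBrangesRovnyak (b : SchurClass n) : Type := RKHS.OfKernel b.kernel

end SchurClass

/-- The integral `∫ φ dμ` of a scalar function, through `dμ = W d(tr μ)`. -/
def MatrixMeasure.integral {n : ℕ} (μ : MatrixMeasure n) (φ : Circle → ℂ) : CMat n :=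
  ∫ ξ, φ ξ • μ.density ξ ∂μ.trace

namespace SchurClass

variable {n : ℕ}

/-- The function `H_α(z) = (I + b(z) α^*) (I - b(z) α^*)⁻¹`. -/
def herglotz (b : SchurClass n) (α : unitary (CMat n)) (z : 𝔻) : CMat n :=
  (1 + b z * star (α : CMat n)) * Ring.inverse (1 - b z * star (α : CMat n))

/-- `μ` is the Aleksandrov–Clark measure of `b` for `α`:
`H_α(z) = i Im H_α(0) + ∫ (ζ + z) / (ζ - z) dμ(ζ)` on the disc, with `Im A = (A - A^*) / (2i)`. -/
def IsClarkMeasure (b : SchurClass n) (α : unitary (CMat n)) (μ : MatrixMeasure n) : Prop :=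
  ∀ z : 𝔻, b.herglotz α z =
    I • ((1 / (2 * I)) • (b.herglotz α 0 - star (b.herglotz α 0))) +
      μ.integral fun ζ => ((ζ : ℂ) + (z : ℂ)) / ((ζ : ℂ) - (z : ℂ))

/-- The operator `Ψ f (z) = (I - b(z)) C[μ f](z)` on `L²(μ)`. -/
def psi (b : SchurClass n) (μ : MatrixMeasure n) : μ.L2 →ₗ[ℂ] (𝔻 → CVec n) where
  toFun F z := (1 - b z) (SeparationQuotient.lift (fun f : μ.L2Fun => μ.cauchyTransform f z)
    (fun _ _ h => μ.cauchyTransform_congr h z) F)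
  map_add' F G := by
    obtain ⟨f, rfl⟩ := SeparationQuotient.surjective_mk F
    obtain ⟨g, rfl⟩ := SeparationQuotient.surjective_mk G
    funext z
    rw [← SeparationQuotient.mk_add]
    simp only [SeparationQuotient.lift_mk, Pi.add_apply, ← map_add]
    rw [← μ.cauchyTransform_add]
  map_smul' c F := by
    obtain ⟨f, rfl⟩ := SeparationQuotient.surjective_mk F
    funext z
    rw [← SeparationQuotient.mk_smul]
    simp only [SeparationQuotient.lift_mk, Pi.smul_apply, ← map_smul, RingHom.id_apply]
    rw [← μ.cauchyTransform_smul]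

theorem psi_toL2 (b : SchurClass n) (μ : MatrixMeasure n) (f : μ.L2Fun) (z : 𝔻) :
    b.psi μ (μ.toL2 f) z = (1 - b z) (μ.cauchyTransform f z) := rfl

/-- The element `k̃_w x` of `L²₊(μ)`, the class of `ξ ↦ (I - b(w)^*) x / (1 - w̄ ξ)`. -/
def kTilde (b : SchurClass n) (μ : MatrixMeasure n) (w : 𝔻) (x : CVec n) : μ.L2plus :=
  ⟨μ.toL2 (μ.fraction w ((1 - star (b w)) x)), μ.fraction_mem_L2plus w _⟩

end SchurClass

end

noncomputable section

/-! Two total families with the same Gram matrix, in two Hilbert spaces, are carried to each other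
by a unitary operator. Here the families are the functions $\widetilde k_w x$ in $L^2_+(\mu)$ and
the kernel functions $k^b_w x$ in $\mathscr H(b)$.

Pairing with a fraction $y/(1-\bar z\xi)$ evaluates the Cauchy transform at $z$, so the factor
$I-b(z)^*$ in $\widetilde k_z$ gives $\langle \widetilde k_z y, f\rangle = \langle y, \Psi
f(z)\rangle$ (`inner_kTilde`). The family is total because $I-b(w)^*$ is invertible, so every
fraction is some $\widetilde k_w x$. Equality of the Gram matrices thus reduces to $\Psi\widetilde
k_w x = k^b_w x$ (`psi_kTilde`). This compares two expressions for $H(z)+H(w)^*$: the Herglotz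
formula makes it $2(1-z\bar w)\int (1-z\bar\xi)^{-1}(1-\bar w\xi)^{-1}\,d\mu$, and the Cayley
transform gives $(I-b(z))(H(z)+H(w)^*)(I-b(w)^*) = 2(I-b(z)b(w)^*)$.

The unitary $U$ so obtained equals $\Psi$, since $\langle y, Uf(z)\rangle = \langle k^b_z y,
Uf\rangle = \langle \widetilde k_z y, f\rangle = \langle y, \Psi f(z)\rangle$.

The analytic point is completeness of $L^2(\mu)$. The map $f\mapsto W^{1/2}f$ is isometric into the
unweighted $L^2(\operatorname{tr}\mu)$, and its range is closed: it consists of the $g$ with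
$g(\xi)\in\operatorname{ran}W(\xi)^{1/2}$ almost everywhere. As $W$ may be singular, a measurable
preimage is built as a limit of $(W^{1/2}+\varepsilon)^{-1}g$. -/

theorem ContinuousOn.measurable_comp {X Y Z : Type*} [MeasurableSpace X] [TopologicalSpace Y]
    [MeasurableSpace Y] [OpensMeasurableSpace Y] [TopologicalSpace Z] [MeasurableSpace Z]
    [BorelSpace Z] {φ : Y → Z} {s : Set Y} (hφ : ContinuousOn φ s) {g : X → Y}
    (hg : Measurable g) (hgs : ∀ x, g x ∈ s) : Measurable fun x => φ (g x) :=
  (continuousOn_iff_continuous_domRestrict.1 hφ).measurable.comp (hg.subtype_mk (h := hgs))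

/-! ### Regularised inverses of a positive matrix -/

namespace CMat

variable {n : ℕ} {S : CMat n}

theorem isUnit_add_smul_one (hS : S.IsPositive) {ε : ℝ} (hε : 0 < ε) :
    IsUnit (S + (ε : ℂ) • (1 : CMat n)) := by
  have h0 : (0 : CMat n) ≤ S := (ContinuousLinearMap.nonneg_iff_isPositive S).2 hS
  have h1 : spectrum ℝ S ⊆ Set.Ici 0 := fun x hx => spectrum_nonneg_of_nonneg h0 hx
  have h2 : -ε ∉ spectrum ℝ S := fun h => by
    have : (0 : ℝ) ≤ -ε := h1 h
    linarith
  have h3 := (spectrum.notMem_iff.1 h2).neg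
  convert h3 using 1
  ext v
  simp [Algebra.algebraMap_eq_smul_one, add_comm]

theorem inverse_add_smul_one_apply (hS : S.IsPositive) {ε : ℝ} (hε : 0 < ε) (v : CVec n) :
    S (Ring.inverse (S + (ε : ℂ) • (1 : CMat n)) v) =
      v - (ε : ℂ) • Ring.inverse (S + (ε : ℂ) • (1 : CMat n)) v := by
  have h := congrArg (fun A : CMat n => A v)
    (Ring.mul_inverse_cancel _ (isUnit_add_smul_one hS hε))
  simp only [mul_apply_eq_comp, add_apply,
    smul_apply, one_apply_eq_self] at h
  rw [eq_sub_iff_add_eq, h]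

theorem inverse_add_smul_one_apply_apply (hS : S.IsPositive) {ε : ℝ} (hε : 0 < ε) (v : CVec n) :
    Ring.inverse (S + (ε : ℂ) • (1 : CMat n)) (S v) =
      v - (ε : ℂ) • Ring.inverse (S + (ε : ℂ) • (1 : CMat n)) v := by
  have h := congrArg (fun A : CMat n => A v)
    (Ring.inverse_mul_cancel _ (isUnit_add_smul_one hS hε))
  simp only [mul_apply_eq_comp, add_apply,
    smul_apply, one_apply_eq_self, map_add, map_smul] at h
  rw [eq_sub_iff_add_eq, h]

/-- With $u=(S+\varepsilon)^{-1}Sv$ one has $S(v-u)=\varepsilon u$. Positivity of $S$ at $v-u$ then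
gives $\|u\|^2\le\operatorname{Re}\langle v,u\rangle\le\|v\|\|u\|$. The bound is uniform in
$\varepsilon$. -/
theorem norm_inverse_add_smul_one_apply_le (hS : S.IsPositive) {ε : ℝ} (hε : 0 < ε)
    (v : CVec n) : ‖Ring.inverse (S + (ε : ℂ) • (1 : CMat n)) (S v)‖ ≤ ‖v‖ := by
  set u := Ring.inverse (S + (ε : ℂ) • (1 : CMat n)) (S v) with hu
  have h1 : S (v - u) = (ε : ℂ) • u := by
    rw [map_sub, hu, inverse_add_smul_one_apply hS hε (S v)]; simp
  have h2 := hS.re_inner_nonneg_right (v - u)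
  rw [h1, inner_smul_right, inner_sub_left] at h2
  have h3 : 0 ≤ ε * (RCLike.re (inner ℂ v u) - ‖u‖ ^ 2) := by
    rw [← inner_self_eq_norm_sq (𝕜 := ℂ) u, ← map_sub]
    simpa using h2
  have h4 := nonneg_of_mul_nonneg_right h3 hε
  have h5 : RCLike.re (inner ℂ v u) ≤ ‖v‖ * ‖u‖ := re_inner_le_norm v u
  by_contra h
  nlinarith [norm_nonneg u, norm_nonneg v]

/-- The difference from $Sv$ is $-\varepsilon(S+\varepsilon)^{-1}Sv$, of norm at most
$\varepsilon\|v\|$. Thus the regularised inverses recover from $S(Sv)$ its preimage lying in the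
range of $S$. -/
theorem tendsto_inverse_add_smul_one_apply (hS : S.IsPositive) (v : CVec n) :
    Filter.Tendsto
      (fun k : ℕ => Ring.inverse (S + (((1 / ((k : ℝ) + 1) : ℝ)) : ℂ) • (1 : CMat n)) (S (S v)))
      Filter.atTop (nhds (S v)) := by
  rw [tendsto_iff_norm_sub_tendsto_zero]
  refine squeeze_zero (g := fun k : ℕ => (1 / ((k : ℝ) + 1)) * ‖v‖) (fun k => norm_nonneg _)
    (fun k => ?_) ?_
  · have hε : 0 < 1 / ((k : ℝ) + 1) := by positivity
    rw [inverse_add_smul_one_apply_apply hS hε (S v), sub_sub_cancel_left, norm_neg, norm_smul,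
      Complex.norm_real, Real.norm_eq_abs, abs_of_pos hε]
    exact mul_le_mul_of_nonneg_left (norm_inverse_add_smul_one_apply_le hS hε v) hε.le
  · simpa using tendsto_one_div_add_atTop_nhds_zero_nat.mul_const ‖v‖

/-- As $S$ is self-adjoint, the orthogonal complement of its range is killed by $S$, so only the
component of $v$ in the range matters. This brings any value of $S$ to the form needed for the
preceding limit. -/
theorem exists_apply_apply_eq (hS : S.IsPositive) (v : CVec n) : ∃ u, S (S u) = S v := by
  obtain ⟨p, hp, q, hq, rfl⟩ :=
    Submodule.exists_add_mem_mem_orthogonal (K := LinearMap.range (S : CVec n →ₗ[ℂ] CVec n)) v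
  obtain ⟨u, rfl⟩ := hp
  refine ⟨u, ?_⟩
  have hq0 : S q = 0 := by
    refine ext_inner_left ℂ fun x => ?_
    rw [inner_zero_right, ← hS.inner_left_eq_inner_right]
    exact Submodule.inner_right_of_mem_orthogonal
      (LinearMap.mem_range_self (S : CVec n →ₗ[ℂ] CVec n) x) hq
  simp [hq0]

theorem continuousOn_inverse : ContinuousOn Ring.inverse {A : CMat n | IsUnit A} := by
  rintro _ ⟨A, rfl⟩
  exact (NormedRing.inverse_continuousAt A).continuousWithinAt

end CMat

/-! ### Completeness of $L^2(\mu)$ through the square root of the density -/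

namespace MatrixMeasure

variable {n : ℕ} (μ : MatrixMeasure n)

/-- The positive square root of the density. -/
def sqrtDensity (ξ : Circle) : CMat n := CFC.sqrt (μ.density ξ)

theorem density_nonneg (ξ : Circle) : 0 ≤ μ.density ξ :=
  (ContinuousLinearMap.nonneg_iff_isPositive _).2 (μ.isPositive_density ξ)

theorem isPositive_sqrtDensity (ξ : Circle) : (μ.sqrtDensity ξ).IsPositive :=
  (ContinuousLinearMap.nonneg_iff_isPositive _).1 (CFC.sqrt_nonneg _)

theorem sqrtDensity_apply_apply (ξ : Circle) (v : CVec n) :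
    μ.sqrtDensity ξ (μ.sqrtDensity ξ v) = μ.density ξ v :=
  congrArg (fun A : CMat n => A v) (CFC.sqrt_mul_sqrt_self _ (μ.density_nonneg ξ))

theorem inner_sqrtDensity (ξ : Circle) (u v : CVec n) :
    inner ℂ (μ.sqrtDensity ξ u) (μ.sqrtDensity ξ v) = inner ℂ u (μ.density ξ v) := by
  rw [(μ.isPositive_sqrtDensity ξ).inner_left_eq_inner_right, sqrtDensity_apply_apply]

theorem norm_sqrtDensity_apply_sq (ξ : Circle) (v : CVec n) :
    ‖μ.sqrtDensity ξ v‖ ^ 2 = (inner ℂ v (μ.density ξ v)).re := by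
  rw [← inner_sqrtDensity]
  exact (inner_self_eq_norm_sq (𝕜 := ℂ) _).symm

theorem measurable_sqrtDensity : Measurable μ.sqrtDensity :=
  CFC.continuousOn_sqrt.measurable_comp μ.measurable_density μ.density_nonneg

theorem measurable_clm_apply {A : Circle → CMat n} {f : Circle → CVec n} (hA : Measurable A)
    (hf : Measurable f) : Measurable fun ξ => A ξ (f ξ) :=
  (by fun_prop : Continuous fun p : CMat n × CVec n => p.1 p.2).measurable.comp (hA.prodMk hf)

theorem memL2_iff {f : Circle → CVec n} (hf : Measurable f) :
    μ.MemL2 f ↔ MemLp (fun ξ => μ.sqrtDensity ξ (f ξ)) 2 μ.trace := by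
  rw [memLp_two_iff_integrable_sq_norm
    (measurable_clm_apply μ.measurable_sqrtDensity hf).aestronglyMeasurable]
  simp only [norm_sqrtDensity_apply_sq]
  exact and_iff_right hf

/-- The isometry `f ↦ W^{1/2} f` into the space of square integrable functions. -/
def toLp : μ.L2Fun →ₗᵢ[ℂ] Lp (CVec n) 2 μ.trace :=
  LinearMap.isometryOfInner
    { toFun := fun f => ((μ.memL2_iff (μ.memL2 f).1).1 (μ.memL2 f)).toLp _
      map_add' := fun f g => by
        rw [← MemLp.toLp_add]
        exact MemLp.toLp_congr _ _ (.of_forall fun ξ => by simp)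
      map_smul' := fun c f => by
        rw [RingHom.id_apply, ← MemLp.toLp_const_smul]
        exact MemLp.toLp_congr _ _ (.of_forall fun ξ => by simp) }
    fun f g => by
      rw [L2.inner_def, inner_def]
      refine integral_congr_ae ?_
      filter_upwards [((μ.memL2_iff (μ.memL2 f).1).1 (μ.memL2 f)).coeFn_toLp,
        ((μ.memL2_iff (μ.memL2 g).1).1 (μ.memL2 g)).coeFn_toLp] with ξ h1 h2
      rw [← inner_sqrtDensity, ← h1, ← h2]
      rfl

theorem coeFn_toLp (f : μ.L2Fun) : μ.toLp f =ᵐ[μ.trace] fun ξ => μ.sqrtDensity ξ (f ξ) :=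
  ((μ.memL2_iff (μ.memL2 f).1).1 (μ.memL2 f)).coeFn_toLp

/-- A pointwise choice of preimages need not be measurable; the limit of the regularised inverses
applied to $g$ is a measurable one. -/
theorem mem_range_toLp {g : Lp (CVec n) 2 μ.trace}
    (hg : ∀ᵐ ξ ∂μ.trace, ∃ v, μ.sqrtDensity ξ v = g ξ) : g ∈ Set.range μ.toLp := by
  -- The regularised root is invertible at every $\xi$, and inversion is continuous on the units, so
  -- measurability survives.
  have hm : ∀ k : ℕ, AEMeasurable (fun ξ => Ring.inverse
      (μ.sqrtDensity ξ + (((1 / ((k : ℝ) + 1) : ℝ)) : ℂ) • (1 : CMat n)) (g ξ)) μ.trace :=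
    fun k => (measurable_clm_apply (CMat.continuousOn_inverse.measurable_comp
      (μ.measurable_sqrtDensity.add_const _) fun ξ =>
        CMat.isUnit_add_smul_one (μ.isPositive_sqrtDensity ξ) (by positivity))
      (Lp.stronglyMeasurable g).measurable).aemeasurable
  have hlim : ∀ᵐ ξ ∂μ.trace, ∃ u, μ.sqrtDensity ξ u = g ξ ∧ Filter.Tendsto (fun k : ℕ =>
      Ring.inverse (μ.sqrtDensity ξ + (((1 / ((k : ℝ) + 1) : ℝ)) : ℂ) • (1 : CMat n)) (g ξ))
      Filter.atTop (nhds u) := by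
    filter_upwards [hg] with ξ ⟨v, hv⟩
    obtain ⟨u, hu⟩ := CMat.exists_apply_apply_eq (μ.isPositive_sqrtDensity ξ) v
    -- The witness is `μ.sqrtDensity ξ u`, the preimage inside the range of the root.
    refine ⟨_, hu.trans hv, ?_⟩
    rw [← hv, ← hu]
    exact CMat.tendsto_inverse_add_smul_one_apply (μ.isPositive_sqrtDensity ξ) u
  obtain ⟨f, hf, hft⟩ := measurable_limit_of_tendsto_metrizable_ae hm
    (hlim.mono fun ξ h => h.imp fun _ h => h.2)
  have hfg : (fun ξ => μ.sqrtDensity ξ (f ξ)) =ᵐ[μ.trace] g := by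
    filter_upwards [hlim, hft] with ξ ⟨u, hu, hu'⟩ h
    rw [tendsto_nhds_unique h hu', hu]
  have hfL : μ.MemL2 f := (μ.memL2_iff hf).2 ((Lp.memLp g).ae_eq hfg.symm)
  refine ⟨⟨f, hfL⟩, Lp.ext ((μ.coeFn_toLp _).trans hfg)⟩

/-- An $L^2$ limit is an almost everywhere limit along a subsequence, and each
$\operatorname{ran}W(\xi)^{1/2}$ is closed, being finite-dimensional. So the pointwise range
condition passes to the limit. -/
theorem isClosed_range_toLp : IsClosed (Set.range μ.toLp) := by
  refine IsSeqClosed.isClosed fun u g hu hug => μ.mem_range_toLp ?_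
  obtain ⟨ns, -, hns⟩ := (tendstoInMeasure_of_tendsto_Lp hug).exists_seq_tendsto_ae
  have h : ∀ᵐ ξ ∂μ.trace, ∀ k, ∃ v, μ.sqrtDensity ξ v = u k ξ := ae_all_iff.2 fun k => by
    obtain ⟨f, hf⟩ := hu k
    filter_upwards [μ.coeFn_toLp f] with ξ h
    exact ⟨f ξ, by rw [← hf, h]⟩
  filter_upwards [hns, h] with ξ h1 h2
  have hc : IsClosed (LinearMap.range (μ.sqrtDensity ξ : CVec n →ₗ[ℂ] CVec n) : Set (CVec n)) :=
    Submodule.closed_of_finiteDimensional _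
  exact hc.mem_of_tendsto h1 (.of_forall fun k => h2 (ns k))

-- `μ.L2Fun` carries only a seminorm, so `toLp` is perhaps not injective; uniform inducing is enough
-- to transfer completeness.
instance : CompleteSpace μ.L2Fun :=
  (completeSpace_iff_isComplete_range μ.toLp.isometry.isUniformInducing).2
    μ.isClosed_range_toLp.isComplete

instance : CompleteSpace μ.L2plus :=
  (Submodule.isClosed_topologicalClosure _).isComplete.completeSpace_coe

end MatrixMeasure

/-! ### Unitary equivalence from equal Gram matrices -/

section Gram

variable {𝕜 ι H H' : Type*} [RCLike 𝕜] [NormedAddCommGroup H] [InnerProductSpace 𝕜 H]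
  [NormedAddCommGroup H'] [InnerProductSpace 𝕜 H']

theorem denseRange_linearCombination_of_inner [CompleteSpace H] {k : ι → H}
    (hk : ∀ f, (∀ i, inner 𝕜 (k i) f = 0) → f = 0) :
    DenseRange (Finsupp.linearCombination 𝕜 k) := by
  rw [DenseRange, ← LinearMap.coe_range, Finsupp.range_linearCombination]
  refine Submodule.dense_iff_topologicalClosure_eq_top.2
    ((Submodule.topologicalClosure_eq_top_iff).2 ((Submodule.eq_bot_iff _).2 fun f hf => ?_))
  exact hk f fun i => Submodule.inner_right_of_mem_orthogonal
    (Submodule.subset_span (Set.mem_range_self i)) hf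

theorem inner_linearCombination (k : ι → H) (c d : ι →₀ 𝕜) :
    inner 𝕜 (Finsupp.linearCombination 𝕜 k c) (Finsupp.linearCombination 𝕜 k d) =
      c.sum fun i a => d.sum fun j e => conj a * (e * inner 𝕜 (k i) (k j)) := by
  simp only [Finsupp.linearCombination_apply, Finsupp.sum, sum_inner, inner_sum, inner_smul_left,
    inner_smul_right, Finset.mul_sum]
  rw [Finset.sum_comm]
  exact Finset.sum_congr rfl fun _ _ => Finset.sum_congr rfl fun _ _ => mul_left_comm _ _ _

/-- Two total families with the same Gram matrix are unitarily equivalent. -/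
theorem exists_linearIsometryEquiv_of_inner_eq [CompleteSpace H] [CompleteSpace H']
    {k : ι → H} {k' : ι → H'}
    (hk : ∀ f, (∀ i, inner 𝕜 (k i) f = 0) → f = 0)
    (hk' : ∀ f, (∀ i, inner 𝕜 (k' i) f = 0) → f = 0)
    (h : ∀ i j, inner 𝕜 (k i) (k j) = inner 𝕜 (k' i) (k' j)) :
    ∃ U : H ≃ₗᵢ[𝕜] H', ∀ i, U (k i) = k' i := by
  -- The norm of a finite combination depends only on its coefficients and the Gram matrix. Hence
  -- the identity on coefficients is isometric between the two dense spans and extends to the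
  -- completions.
  have hn : ∀ c : ι →₀ 𝕜, ‖Finsupp.linearCombination 𝕜 k' (LinearEquiv.refl 𝕜 _ c)‖ =
      ‖Finsupp.linearCombination 𝕜 k c‖ := fun c => by
    rw [LinearEquiv.refl_apply, norm_eq_sqrt_re_inner (𝕜 := 𝕜), norm_eq_sqrt_re_inner (𝕜 := 𝕜),
      inner_linearCombination, inner_linearCombination]
    simp only [h]
  refine ⟨(LinearEquiv.refl 𝕜 (ι →₀ 𝕜)).extendOfIsometry _ _
    (denseRange_linearCombination_of_inner hk) (denseRange_linearCombination_of_inner hk') hn,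
    fun i => ?_⟩
  have e := (LinearEquiv.refl 𝕜 (ι →₀ 𝕜)).extendOfIsometry_eq _ _
    (denseRange_linearCombination_of_inner hk) (denseRange_linearCombination_of_inner hk') hn
    (Finsupp.single i 1)
  simpa using e

end Gram

/-! ### Cauchy transforms as inner products with fractions -/

namespace MatrixMeasure

variable {n : ℕ} (μ : MatrixMeasure n)

/-- The inner product conjugates the scalar $1/(1-\bar w\xi)$ into the Cauchy kernel
$1/(1-w\bar\xi)$. -/
theorem inner_fraction (w : 𝔻) (y : CVec n) (f : μ.L2Fun) :
    inner ℂ (μ.toL2 (μ.fraction w y)) (μ.toL2 f) = inner ℂ y (μ.cauchyTransform f w) := by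
  change inner ℂ (μ.fraction w y) f = _
  rw [inner_def, cauchyTransform, ← integral_inner (μ.integrable_cauchyTransform f w)]
  refine integral_congr_ae (.of_forall fun ξ => ?_)
  change inner ℂ ((1 / (1 - conj (w : ℂ) * (ξ : ℂ))) • y) _ = _
  simp [inner_smul_right, mul_comm]

/-- Such an $f$ is orthogonal to the closed span of the fractions, which contains $f$ itself. -/
theorem eq_zero_of_inner_fraction {f : μ.L2} (hf : f ∈ μ.L2plus)
    (h : ∀ w x, inner ℂ (μ.toL2 (μ.fraction w x)) f = 0) : f = 0 := by
  have hle : μ.L2plus ≤ (ℂ ∙ f)ᗮ := by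
    refine Submodule.topologicalClosure_minimal _ (Submodule.span_le.2 ?_)
      (Submodule.isClosed_orthogonal _)
    rintro _ ⟨w, x, rfl⟩
    exact Submodule.mem_orthogonal_singleton_iff_inner_left.2 (h w x)
  exact inner_self_eq_zero.1 (Submodule.mem_orthogonal_singleton_iff_inner_left.1 (hle hf))

theorem star_integral (φ : Circle → ℂ) :
    star (μ.integral φ) = μ.integral fun ξ => conj (φ ξ) := by
  have h := (starL' ℝ : CMat n ≃L[ℝ] CMat n).integral_comp_comm
    (μ := μ.trace) fun ξ => φ ξ • μ.density ξ
  refine h.symm.trans (integral_congr_ae (.of_forall fun ξ => ?_))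
  change star (φ ξ • μ.density ξ) = _
  rw [star_smul, (μ.isPositive_density ξ).isSelfAdjoint.star_eq]
  rfl

theorem integral_add {φ ψ : Circle → ℂ} (hφ : Continuous φ) (hψ : Continuous ψ) :
    μ.integral (fun ξ => φ ξ + ψ ξ) = μ.integral φ + μ.integral ψ := by
  refine (integral_congr_ae (.of_forall fun ξ => add_smul (φ ξ) (ψ ξ) (μ.density ξ))).trans ?_
  exact MeasureTheory.integral_add (integrable_continuous_smul hφ μ.integrable_density)
    (integrable_continuous_smul hψ μ.integrable_density)

theorem integral_const_mul (c : ℂ) (φ : Circle → ℂ) :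
    μ.integral (fun ξ => c * φ ξ) = c • μ.integral φ := by
  simp only [integral, mul_smul]
  exact integral_smul _ _

theorem one_sub_mul_conj_ne_zero (z : 𝔻) (ξ : Circle) : 1 - (z : ℂ) * conj (ξ : ℂ) ≠ 0 :=
  fun h => one_sub_ne_zero z ξ (by simpa using congrArg conj h)

theorem cauchyTransform_fraction (z w : 𝔻) (y : CVec n) :
    μ.cauchyTransform (μ.fraction w y) z = μ.integral (fun ξ =>
      (1 / (1 - (z : ℂ) * conj (ξ : ℂ))) * (1 / (1 - conj (w : ℂ) * (ξ : ℂ)))) y := by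
  rw [integral, ContinuousLinearMap.integral_apply]
  · refine integral_congr_ae (.of_forall fun ξ => ?_)
    change _ • μ.density ξ ((1 / (1 - conj (w : ℂ) * (ξ : ℂ))) • y) = _
    simp [mul_smul]
  · refine integrable_continuous_smul (.mul ?_ ?_) μ.integrable_density
    · exact continuous_const.div (by fun_prop) (one_sub_mul_conj_ne_zero z)
    · exact continuous_const.div (by fun_prop) (one_sub_ne_zero w)

end MatrixMeasure

/-! ### Algebra of the Cayley transform -/

section StarRing

variable {R : Type*} [Ring R]

theorem one_sub_mul_cayley {a : R} (ha : IsUnit (1 - a)) :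
    (1 - a) * ((1 + a) * Ring.inverse (1 - a)) = 1 + a := by
  have hc : (1 - a) * (1 + a) = (1 + a) * (1 - a) := by noncomm_ring
  rw [← mul_assoc, hc, mul_assoc, Ring.mul_inverse_cancel _ ha, mul_one]

theorem isUnit_one_sub_star_of [StarRing R] {a : R} (ha : IsUnit (1 - a)) : IsUnit (1 - star a) := by
  simpa using ha.star

/-- The outer factors cancel one inverse each, leaving $(1+a)(1-c^*)+(1-a)(1+c^*)$, where the terms
linear in $a$ and in $c^*$ drop out. -/
theorem mul_cayley_add_star_mul [StarRing R] [Module ℂ R] {a c : R} (ha : IsUnit (1 - a))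
    (hc : IsUnit (1 - c)) :
    (1 - a) * ((1 + a) * Ring.inverse (1 - a) + star ((1 + c) * Ring.inverse (1 - c))) *
      (1 - star c) = (2 : ℂ) • (1 - a * star c) := by
  have h : star ((1 + c) * Ring.inverse (1 - c)) * (1 - star c) = 1 + star c := by
    have := congrArg star (one_sub_mul_cayley hc)
    rwa [star_mul, star_sub, star_add, star_one] at this
  rw [mul_add, add_mul, one_sub_mul_cayley ha, mul_assoc, h, two_smul]
  noncomm_ring

/-- The constant $i\operatorname{Im}a$ is skew-adjoint, so it cancels against its adjoint; this
removes $i\operatorname{Im}H(0)$ from $H(z)+H(w)^*$. -/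
theorem skew_add_add_star [StarRing R] [Module ℂ R] [StarModule ℂ R] (a x y : R) :
    I • ((1 / (2 * I)) • (a - star a)) + x + star (I • ((1 / (2 * I)) • (a - star a)) + y) =
      x + star y := by
  have h : I * (1 / (2 * I)) = 1 / 2 := by field_simp
  have h2 : star (1 / 2 : ℂ) = 1 / 2 := by simp
  rw [smul_smul, h, star_add, star_smul, star_sub, star_star, h2, smul_sub, smul_sub]
  abel

theorem eq_smul_of_two_smul_eq [Algebra ℂ R] {k : ℂ} (hk : k ≠ 0) {p q g s : R}
    (h : p * ((2 * k) • g) * q = (2 : ℂ) • s) : (1 / k) • s = p * g * q := by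
  rw [mul_smul_comm, smul_mul_assoc, mul_smul] at h
  rw [← smul_right_injective R (two_ne_zero (α := ℂ)) h, smul_smul, one_div_mul_cancel hk,
    one_smul]

end StarRing

/-! ### The Herglotz formula and the functions $\widetilde k_w x$ -/

namespace SchurClass

variable {n : ℕ} (b : SchurClass n)

theorem isUnit_one_sub (z : 𝔻) : IsUnit (1 - b z) :=
  isUnit_one_sub_of_norm_lt_one (b.norm_lt_one z (by simp [z.norm_lt_one]))

theorem isUnit_one_sub_star (z : 𝔻) : IsUnit (1 - star (b z)) :=
  isUnit_one_sub_star_of (b.isUnit_one_sub z)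

theorem herglotz_one (z : 𝔻) : b.herglotz 1 z = (1 + b z) * Ring.inverse (1 - b z) := by
  simp only [herglotz, OneMemClass.coe_one, star_one, mul_one]

theorem mul_herglotz_add_star_mul (z w : 𝔻) :
    (1 - b z) * (b.herglotz 1 z + star (b.herglotz 1 w)) * (1 - star (b w)) =
      (2 : ℂ) • (1 - b z * star (b w)) := by
  rw [herglotz_one, herglotz_one]
  exact mul_cayley_add_star_mul (b.isUnit_one_sub z) (b.isUnit_one_sub w)

variable {b} {μ : MatrixMeasure n}

/-- Under the integral this is the scalar identity
$\frac{\xi+z}{\xi-z}+\overline{\left(\frac{\xi+w}{\xi-w}\right)}=\frac{2(1-z\bar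
w)}{(1-z\bar\xi)(1-\bar w\xi)}$, valid because $\xi\bar\xi=1$. -/
theorem IsClarkMeasure.herglotz_add_star (hμ : b.IsClarkMeasure 1 μ) (z w : 𝔻) :
    b.herglotz 1 z + star (b.herglotz 1 w) = (2 * (1 - (z : ℂ) * conj (w : ℂ))) •
      μ.integral (fun ξ =>
        (1 / (1 - (z : ℂ) * conj (ξ : ℂ))) * (1 / (1 - conj (w : ℂ) * (ξ : ℂ)))) := by
  have hne : ∀ (z : 𝔻) (ξ : Circle), (ξ : ℂ) - z ≠ 0 := fun z ξ h =>
    z.norm_ne_one (by rw [← sub_eq_zero.1 h, Circle.norm_coe])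
  have hc : ∀ z : 𝔻, Continuous fun ξ : Circle => ((ξ : ℂ) + z) / ((ξ : ℂ) - z) := fun z =>
    .div (by fun_prop) (by fun_prop) (hne z)
  rw [hμ z, hμ w]
  refine (skew_add_add_star _ _ _).trans ?_
  rw [μ.star_integral, ← μ.integral_const_mul]
  refine (μ.integral_add (hc z) (Complex.continuous_conj.comp (hc w))).symm.trans ?_
  refine congrArg μ.integral (funext fun ξ => ?_)
  rw [Function.comp_apply]
  have h1 : (ξ : ℂ) * conj (ξ : ℂ) = 1 := by
    rw [Complex.mul_conj, Complex.normSq_eq_norm_sq, Circle.norm_coe]; simp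
  have h2 := hne z ξ
  have h3 : conj (ξ : ℂ) - conj (w : ℂ) ≠ 0 := by
    rw [← map_sub]; exact (map_ne_zero _).2 (hne w ξ)
  have h4 : 1 - (z : ℂ) * conj (ξ : ℂ) = conj (ξ : ℂ) * ((ξ : ℂ) - z) := by
    linear_combination -h1
  have h5 : 1 - conj (w : ℂ) * (ξ : ℂ) = ξ * (conj (ξ : ℂ) - conj (w : ℂ)) := by
    linear_combination -h1
  have h6 : (1 / (1 - (z : ℂ) * conj (ξ : ℂ))) * (1 / (1 - conj (w : ℂ) * (ξ : ℂ))) =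
      1 / (((ξ : ℂ) - z) * (conj (ξ : ℂ) - conj (w : ℂ))) := by
    rw [h4, h5, div_mul_div_comm, one_mul]
    congr 1
    linear_combination ((ξ : ℂ) - z) * (conj (ξ : ℂ) - conj (w : ℂ)) * h1
  rw [h6, map_div₀, map_add, map_sub]
  field_simp
  linear_combination 2 * h1

theorem IsClarkMeasure.psi_kTilde (hμ : b.IsClarkMeasure 1 μ) (z w : 𝔻) (x : CVec n) :
    b.psi μ (b.kTilde μ w x) z = b.kernel z w x := by
  have hne : 1 - (z : ℂ) * conj (w : ℂ) ≠ 0 := by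
    rw [mul_comm]; exact one_sub_conj_mul_ne_zero w z.norm_lt_one.le
  have h := b.mul_herglotz_add_star_mul z w
  rw [hμ.herglotz_add_star] at h
  change b.psi μ (μ.toL2 _) z = _
  rw [psi_toL2, μ.cauchyTransform_fraction]
  exact congrArg (fun A : CMat n => A x) (eq_smul_of_two_smul_eq hne h).symm

/-- The factor $I-b(z)^*$ moves across the inner product as $I-b(z)$, turning the Cauchy transform
into $\Psi f(z)$. This is the reproducing property that $\mathscr H(b)$ has for $k^b_z y$. -/
theorem inner_kTilde (f : μ.L2plus) (z : 𝔻) (y : CVec n) :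
    inner ℂ (b.kTilde μ z y) f = inner ℂ y (b.psi μ f z) := by
  obtain ⟨f, hf⟩ := f
  obtain ⟨g, rfl⟩ := SeparationQuotient.surjective_mk f
  change inner ℂ (μ.toL2 (μ.fraction z _)) (μ.toL2 g) = inner ℂ y (b.psi μ (μ.toL2 g) z)
  rw [psi_toL2, μ.inner_fraction, ← ContinuousLinearMap.adjoint_inner_left,
    ← ContinuousLinearMap.star_eq_adjoint]
  simp [inner_sub_left]

/-- Replacing $x$ by $(I-b(w)^*)^{-1}x$ turns $\widetilde k_w x$ into the fraction with numerator
$x$, so totality is inherited from the fractions. -/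
theorem eq_zero_of_inner_kTilde (f : μ.L2plus)
    (h : ∀ p : 𝔻 × CVec n, inner ℂ (b.kTilde μ p.1 p.2) f = 0) : f = 0 := by
  refine Subtype.ext (μ.eq_zero_of_inner_fraction f.2 fun w x => ?_)
  have e : (1 - star (b w)) (Ring.inverse (1 - star (b w)) x) = x :=
    congrArg (fun A : CMat n => A x) (Ring.mul_inverse_cancel _ (b.isUnit_one_sub_star w))
  have h1 := h (w, Ring.inverse (1 - star (b w)) x)
  change inner ℂ (μ.toL2 (μ.fraction w _)) (f : μ.L2) = 0 at h1
  rwa [e] at h1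

end SchurClass

end

/-! ### The unitary operator and its identification with $\Psi$ -/

theorem lemma8p4 {n : ℕ} (b : SchurClass n) (μ : MatrixMeasure n)
    (hμ : b.IsClarkMeasure 1 μ) :
    ∃ U : μ.L2plus ≃ₗᵢ[ℂ] b.deBrangesRovnyak,
      (∀ (f : μ.L2plus) (z : 𝔻), U f z = b.psi μ f z) ∧
      (∀ (w : 𝔻) (x : CVec n),
        U (b.kTilde μ w x) = RKHS.kerFun b.deBrangesRovnyak w x ∧
        ∀ z : 𝔻, b.psi μ (b.kTilde μ w x) z = b.kernel z w x) := by
  obtain ⟨U, hU⟩ := exists_linearIsometryEquiv_of_inner_eq (𝕜 := ℂ)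
    (k := fun p : 𝔻 × CVec n => b.kTilde μ p.1 p.2)
    (k' := fun p : 𝔻 × CVec n => RKHS.kerFun b.deBrangesRovnyak p.1 p.2)
    SchurClass.eq_zero_of_inner_kTilde
    (fun f hf => RKHS.ext fun z => ext_inner_left ℂ fun y => by
      rw [← RKHS.kerFun_inner, hf (z, y)]; simp)
    -- For $p=(z,y)$ and $q=(w,x)$ both Gram entries equal $\langle y, k^b(z,w)x\rangle$.
    (fun p q => by
      rw [SchurClass.inner_kTilde, hμ.psi_kTilde, RKHS.kerFun_inner, RKHS.kerFun_apply,
        RKHS.OfKernel.kernel_ofKernel])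
  refine ⟨U, fun f z => ext_inner_left ℂ fun y => ?_, fun w x => ⟨hU (w, x), fun z =>
    hμ.psi_kTilde z w x⟩⟩
  -- Evaluation at $z$ against $y$ is the inner product with $k^b_z y=U\widetilde k_z y$, and $U$
  -- preserves inner products.
  rw [← RKHS.kerFun_inner, ← hU (z, y), U.inner_map_map, SchurClass.inner_kTilde]
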